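/- Fix countably many propositional variables. Let $\mathcal L(\Box,\rhd)$-formulas be given by $A ::= \bot \mid p \mid A\to A \mid \Box A \mid A\rhd A$ and $\mathcal L(\Box,\mathsf I)$-formulas by $A ::= \bot \mid p \mid A\to A \mid \Box A \mid \mathsf I A$; the connectives $\top,\neg,\land,\lor,\leftrightarrow$ are defined as usual and $\Diamond A := \neg\Box\neg A$. Every $\mathcal L(\Box,\mathsf I)$-formula is read as an $\mathcal L(\Box,\rhd)$-formula by letting $\mathsf I A$ abbreviate $\top\rhd A$. The logic $\mathbf{IL}^-$ has as axioms all $\mathcal L(\Box,\rhd)$-tautologies, $\Box(A\to B)\to(\Box A\to\Box B)$, $\Box(\Box A\to A)\to\Box A$, $\mathbf{J3}$: $(A\rhd C)\land(B\rhd C)\to(A\lor B)\rhd C$, and $\mathbf{J6}$: $\Box A\leftrightarrow(\neg A\rhd\bot)$; its rules are Modus Ponens, Necessitation, from $A\to B$ infer $(C\rhd A)\to(C\rhd B)$, and from $A\to B$ infer $(B\rhd C)\to(A\rhd C)$. Consider the schemata - $\mathbf{J1}$: $\Box(A\to B)\to A\rhd B$; - $\mathbf{J2}$: $(A\rhd B)\land(B\rhd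 C)\to A\rhd C$; - $\mathbf{J2}_+$: $(A\rhd(B\lor C))\land(B\rhd C)\to A\rhd C$; - $\mathbf{J4}$: $A\rhd B\to(\Diamond A\to\Diamond B)$; - $\mathbf{J4}_+$: $\Box(A\to B)\to(C\rhd A\to C\rhd B)$; - $\mathbf{J5}$: $\Diamond A\rhd A$. The logic $\mathbf{CL}$ has as axioms all $\mathcal L(\Box,\rhd)$-tautologies, $\Box(A\to B)\to(\Box A\to\Box B)$, $\Box(\Box A\to A)\to\Box A$, $\mathbf{J1}$, $\mathbf{J2}$, $\mathbf{J3}$ and $\mathbf{J4}$, and the rules Modus Ponens and Necessitation. The logic $\mathbf{il}^-$ has as axioms all $\mathcal L(\Box,\mathsf I)$-tautologies, $\Box(A\to B)\to(\Box A\to\Box B)$, $\Box(\Box A\to A)\to\Box A$, and $\Box\bot\leftrightarrow\mathsf I\bot$; its rules are Modus Ponens, Necessitation, and from $A\to B$ infer $\mathsf I A\to\mathsf I B$. Consider also the schemata $\mathbf{J1}'$: $\Box A\to\mathsf I A$ and $\mathbf{I2}$: $\Box(A\to B)\to(\mathsf I A\to\mathsf I B)$. For a logic $M$ and schemata $\Sigma_1,\dots,\Sigma_k$,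 $M(\Sigma_1,\dots,\Sigma_k)$ is $M$ with these schemata added as axioms (its rules then apply to the extended system). A logic is identified with its set of theorems, and $L\vdash A$ means $A\in L$. **Statement.** Let $A$ be any $\mathcal L(\Box,\mathsf I)$-formula, and let $L$ be any set of $\mathcal L(\Box,\rhd)$-formulas (in particular, any logic). 1. If $\mathbf{IL}^-\subseteq L\subseteq\mathbf{IL}^-(\mathbf{J5})$, then $L\vdash A$ if and only if $\mathbf{il}^-\vdash A$. 2. If $\mathbf{IL}^-(\mathbf{J4}_+)\subseteq L\subseteq\mathbf{IL}^-(\mathbf{J4}_+,\mathbf{J5})$ or $\mathbf{IL}^-(\mathbf{J4}_+)\subseteq L\subseteq\mathbf{IL}^-(\mathbf{J2}_+)$, then $L\vdash A$ if and only if $\mathbf{il}^-(\mathbf{I2})\vdash A$. 3. If $\mathbf{IL}^-(\mathbf{J1},\mathbf{J4}_+)\subseteq L\subseteq\mathbf{CL}$, then $L\vdash A$ if and only if $\mathbf{il}^-(\mathbf{J1}',\mathbf{I2})\vdash A$. -/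

import Mathlib

namespace IntLogic

/-! ### The language with `□` and `▷` -/

/-- Formulas `A ::= ⊥ | p | A → A | □ A | A ▷ A` over countably many variables. -/
inductive BFormula : Type
  | bot : BFormula
  | var : ℕ → BFormula
  | imp : BFormula → BFormula → BFormula
  | box : BFormula → BFormula
  | rhd : BFormula → BFormula → BFormula

namespace BFormula

def neg (A : BFormula) : BFormula := A.imp bot

def top : BFormula := bot.imp bot

def or (A B : BFormula) : BFormula := A.neg.imp B

def and (A B : BFormula) : BFormula := (A.imp B.neg).neg

def iff (A B : BFormula) : BFormula := (A.imp B).and (B.imp A)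

def dia (A : BFormula) : BFormula := A.neg.box.neg

/-- `A` is true under every assignment of truth values to formulas that respects `⊥` and `→`
(formulas `□ B` and `B ▷ C` are treated as atoms). -/
def IsTautology (A : BFormula) : Prop :=
  ∀ v : BFormula → Prop, ¬ v bot → (∀ B C, v (B.imp C) ↔ (v B → v C)) → v A

end BFormula

/-! Axiom schemata, each given as the set of its instances. -/

/-- All tautologies. -/
def G1 : Set BFormula := {F | F.IsTautology}

/-- `□(A → B) → (□A → □B)` -/
def G2 : Set BFormula := {F | ∃ A B : BFormula, F = (A.imp B).box.imp (A.box.imp B.box)}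

/-- `□(□A → A) → □A` -/
def G3 : Set BFormula := {F | ∃ A : BFormula, F = (A.box.imp A).box.imp A.box}

/-- `□(A → B) → A ▷ B` -/
def J1 : Set BFormula := {F | ∃ A B : BFormula, F = (A.imp B).box.imp (A.rhd B)}

/-- `(A ▷ B) ∧ (B ▷ C) → A ▷ C` -/
def J2 : Set BFormula :=
  {F | ∃ A B C : BFormula, F = ((A.rhd B).and (B.rhd C)).imp (A.rhd C)}

/-- `(A ▷ (B ∨ C)) ∧ (B ▷ C) → A ▷ C` -/
def J2plus : Set BFormula :=
  {F | ∃ A B C : BFormula, F = ((A.rhd (B.or C)).and (B.rhd C)).imp (A.rhd C)}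

/-- `(A ▷ C) ∧ (B ▷ C) → (A ∨ B) ▷ C` -/
def J3 : Set BFormula :=
  {F | ∃ A B C : BFormula, F = ((A.rhd C).and (B.rhd C)).imp ((A.or B).rhd C)}

/-- `A ▷ B → (◇A → ◇B)` -/
def J4 : Set BFormula := {F | ∃ A B : BFormula, F = (A.rhd B).imp (A.dia.imp B.dia)}

/-- `□(A → B) → (C ▷ A → C ▷ B)` -/
def J4plus : Set BFormula :=
  {F | ∃ A B C : BFormula, F = (A.imp B).box.imp ((C.rhd A).imp (C.rhd B))}

/-- `◇A ▷ A` -/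
def J5 : Set BFormula := {F | ∃ A : BFormula, F = A.dia.rhd A}

/-- `□A ↔ (¬A ▷ ⊥)` -/
def J6 : Set BFormula := {F | ∃ A : BFormula, F = A.box.iff (A.neg.rhd BFormula.bot)}

/-- `ILMinus X` is the set of theorems of the logic `IL⁻(X)`: axioms `G1`, `G2`, `G3`, `J3`, `J6`
and the instances in `X`; rules Modus Ponens, Necessitation, `R1` and `R2`. -/
inductive ILMinus (X : Set BFormula) : Set BFormula
  | base {A : BFormula} (h : A ∈ G1 ∪ G2 ∪ G3 ∪ J3 ∪ J6) : ILMinus X A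
  | extra {A : BFormula} (h : A ∈ X) : ILMinus X A
  | mp {A B : BFormula} (h₁ : ILMinus X A) (h₂ : ILMinus X (A.imp B)) : ILMinus X B
  | nec {A : BFormula} (h : ILMinus X A) : ILMinus X A.box
  | r1 {A B : BFormula} (C : BFormula) (h : ILMinus X (A.imp B)) :
      ILMinus X ((C.rhd A).imp (C.rhd B))
  | r2 {A B : BFormula} (C : BFormula) (h : ILMinus X (A.imp B)) :
      ILMinus X ((B.rhd C).imp (A.rhd C))

/-- The set of theorems of the conservativity logic `CL`: axioms `G1`, `G2`, `G3`, `J1`, `J2`,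
`J3`, `J4` (those of `IL` without `J5`); rules Modus Ponens and Necessitation. -/
inductive CL : Set BFormula
  | ax {A : BFormula} (h : A ∈ G1 ∪ G2 ∪ G3 ∪ J1 ∪ J2 ∪ J3 ∪ J4) : CL A
  | mp {A B : BFormula} (h₁ : CL A) (h₂ : CL (A.imp B)) : CL B
  | nec {A : BFormula} (h : CL A) : CL A.box

/-! ### The language with `□` and the unary operator `I` -/

/-- Formulas `A ::= ⊥ | p | A → A | □ A | I A` over the same variables. -/
inductive UFormula : Type
  | bot : UFormula
  | var : ℕ → UFormula
  | imp : UFormula → UFormula → UFormula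
  | box : UFormula → UFormula
  | int : UFormula → UFormula

namespace UFormula

def neg (A : UFormula) : UFormula := A.imp bot

def and (A B : UFormula) : UFormula := (A.imp B.neg).neg

def iff (A B : UFormula) : UFormula := (A.imp B).and (B.imp A)

/-- `A` is true under every assignment of truth values to formulas that respects `⊥` and `→`
(formulas `□ B` and `I B` are treated as atoms). -/
def IsTautology (A : UFormula) : Prop :=
  ∀ v : UFormula → Prop, ¬ v bot → (∀ B C, v (B.imp C) ↔ (v B → v C)) → v A

/-- The formula with `□` and `▷` that `A` abbreviates: `I B` stands for `⊤ ▷ B`. -/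
def toB : UFormula → BFormula
  | bot => BFormula.bot
  | var n => BFormula.var n
  | imp A B => A.toB.imp B.toB
  | box A => A.toB.box
  | int A => BFormula.top.rhd A.toB

end UFormula

/-- All tautologies of the unary language. -/
def uG1 : Set UFormula := {F | F.IsTautology}

/-- `□(A → B) → (□A → □B)` -/
def uG2 : Set UFormula := {F | ∃ A B : UFormula, F = (A.imp B).box.imp (A.box.imp B.box)}

/-- `□(□A → A) → □A` -/
def uG3 : Set UFormula := {F | ∃ A : UFormula, F = (A.box.imp A).box.imp A.box}

/-- `□⊥ ↔ I⊥` -/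
def uJ6 : Set UFormula := {UFormula.bot.box.iff UFormula.bot.int}

/-- `□A → I A` -/
def uJ1 : Set UFormula := {F | ∃ A : UFormula, F = A.box.imp A.int}

/-- `□(A → B) → (I A → I B)` -/
def I2 : Set UFormula := {F | ∃ A B : UFormula, F = (A.imp B).box.imp (A.int.imp B.int)}

/-- `ilMinus X` is the set of theorems of the unary logic `il⁻(X)`: axioms `uG1`, `uG2`, `uG3`,
`uJ6` and the instances in `X`; rules Modus Ponens, Necessitation, and from `A → B` infer
`I A → I B`. -/
inductive ilMinus (X : Set UFormula) : Set UFormula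
  | base {A : UFormula} (h : A ∈ uG1 ∪ uG2 ∪ uG3 ∪ uJ6) : ilMinus X A
  | extra {A : UFormula} (h : A ∈ X) : ilMinus X A
  | mp {A B : UFormula} (h₁ : ilMinus X A) (h₂ : ilMinus X (A.imp B)) : ilMinus X B
  | nec {A : UFormula} (h : ilMinus X A) : ilMinus X A.box
  | r {A B : UFormula} (h : ilMinus X (A.imp B)) : ilMinus X (A.int.imp B.int)

end IntLogic

namespace IntLogic

/-! ### Embedding the unary logics into the binary ones -/

/-! The argument is purely syntactic. Since `L` is trapped between two logics, it suffices to embed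
the unary logic into the lower one and to come back from the upper one. The embedding is an
induction on derivations (`toB_mem_ILMinus`). For the return, `▷` is interpreted by a unary-language
formula `τ A B` such that the unary logic proves the translation of every theorem of the upper
logic, and proves `τ ⊤ B ↔ I B`. By the latter, translating the reading of `A` gives a formula
equivalent to `A` (`toU_toB_iff`), so `A` is provable. Each `τ` has the form `□(…) ∨ I B`, with the
boxed disjunct chosen for the upper logic: `□(A → ◇B)` handles J5, `□¬A` handles J2₊, and `□(A → B)`
handles `CL`. -/

theorem UFormula.IsTautology.toB {A : UFormula} (h : A.IsTautology) : A.toB.IsTautology :=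
  fun v hb hi => h (fun F => v F.toB) hb fun _ _ => hi _ _

/-- If `IL⁻(Y)` proves the readings of the formulas in `X`, then it proves the readings of all
theorems of `il⁻(X)`. -/
theorem toB_mem_ILMinus {X : Set UFormula} {Y : Set BFormula}
    (hX : ∀ A ∈ X, A.toB ∈ ILMinus Y) {A : UFormula} (hA : A ∈ ilMinus X) :
    A.toB ∈ ILMinus Y := by
  change ilMinus X A at hA
  change ILMinus Y A.toB
  induction hA with
  | base h =>
    refine .base ?_
    rcases h with ((h | ⟨A, B, rfl⟩) | ⟨A, rfl⟩) | rfl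
    · exact .inl (.inl (.inl (.inl h.toB)))
    · exact .inl (.inl (.inl (.inr ⟨_, _, rfl⟩)))
    · exact .inl (.inl (.inr ⟨_, rfl⟩))
    · exact .inr ⟨.bot, rfl⟩
  | extra h => exact hX _ h
  | mp _ _ ih₁ ih₂ => exact .mp ih₁ ih₂
  | nec _ ih => exact .nec ih
  | r _ ih => exact .r1 _ ih

theorem toB_I2_mem {Y : Set BFormula} (hY : J4plus ⊆ Y) {A : UFormula} (hA : A ∈ I2) :
    A.toB ∈ ILMinus Y := by
  obtain ⟨A, B, rfl⟩ := hA
  exact .extra (hY ⟨_, _, _, rfl⟩)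

theorem toB_uJ1_mem {Y : Set BFormula} (hY : J1 ⊆ Y) {A : UFormula} (hA : A ∈ uJ1) :
    A.toB ∈ ILMinus Y := by
  obtain ⟨A, rfl⟩ := hA
  have weaken : ILMinus Y (A.toB.imp (BFormula.top.imp A.toB)) :=
    .base (.inl (.inl (.inl (.inl fun v hb hi => by
      rw [hi, hi]; exact fun h _ => h))))
  have box_weaken : ILMinus Y (A.toB.box.imp (BFormula.top.imp A.toB).box) :=
    .mp (.nec weaken) (.base (.inl (.inl (.inl (.inr ⟨_, _, rfl⟩)))))
  have rhd : ILMinus Y ((BFormula.top.imp A.toB).box.imp (BFormula.top.rhd A.toB)) :=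
    .extra (hY ⟨_, _, rfl⟩)
  refine .mp rhd (.mp box_weaken (.base (.inl (.inl (.inl (.inl fun v hb hi => ?_))))))
  simp only [UFormula.toB, hi]
  exact fun h₁ h₂ h => h₂ (h₁ h)

/-! ### Derivations in the unary logics -/

namespace UFormula

def top : UFormula := bot.imp bot

def or (A B : UFormula) : UFormula := A.neg.imp B

def dia (A : UFormula) : UFormula := A.neg.box.neg

/-- A truth assignment to formulas that respects `⊥` and `→`. -/
structure IsValuation (v : UFormula → Prop) : Prop where
  bot : ¬ v bot
  imp : ∀ B C, v (B.imp C) ↔ (v B → v C)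

namespace IsValuation

variable {v : UFormula → Prop}

theorem neg (hv : IsValuation v) (A : UFormula) : v A.neg ↔ ¬ v A := by
  simp [UFormula.neg, hv.imp, hv.bot]

theorem top (hv : IsValuation v) : v UFormula.top := by
  simp [UFormula.top, hv.imp]

theorem and (hv : IsValuation v) (A B : UFormula) : v (A.and B) ↔ v A ∧ v B := by
  simp [UFormula.and, hv.imp, hv.neg]

theorem or (hv : IsValuation v) (A B : UFormula) : v (A.or B) ↔ v A ∨ v B := by
  simp only [UFormula.or, hv.imp, hv.neg]; tauto

theorem iff (hv : IsValuation v) (A B : UFormula) : v (A.iff B) ↔ (v A ↔ v B) := by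
  simp only [UFormula.iff, hv.imp, hv.and]; tauto

end IsValuation

end UFormula

namespace ilMinus

variable {X : Set UFormula} {A B C D : UFormula}

theorem taut (h : ∀ v, UFormula.IsValuation v → v A) : ilMinus X A :=
  .base (.inl (.inl (.inl fun v hb hi => h v ⟨hb, hi⟩)))

theorem taut₁ (hA : ilMinus X A) (h : ∀ v, UFormula.IsValuation v → v A → v B) : ilMinus X B :=
  .mp hA (taut fun v hv => (hv.imp _ _).2 (h v hv))

theorem taut₂ (hA : ilMinus X A) (hB : ilMinus X B)
    (h : ∀ v, UFormula.IsValuation v → v A → v B → v C) : ilMinus X C :=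
  .mp hB (taut₁ hA fun v hv a => (hv.imp _ _).2 (h v hv a))

theorem taut₃ (hA : ilMinus X A) (hB : ilMinus X B) (hC : ilMinus X C)
    (h : ∀ v, UFormula.IsValuation v → v A → v B → v C → v D) : ilMinus X D :=
  .mp hC (taut₂ hA hB fun v hv a b => (hv.imp _ _).2 (h v hv a b))

theorem trans (h₁ : ilMinus X (A.imp B)) (h₂ : ilMinus X (B.imp C)) : ilMinus X (A.imp C) :=
  taut₂ h₁ h₂ fun v hv => by simp only [hv.imp]; tauto

theorem box_imp : ilMinus X ((A.imp B).box.imp (A.box.imp B.box)) :=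
  .base (.inl (.inl (.inr ⟨_, _, rfl⟩)))

theorem loeb : ilMinus X ((A.box.imp A).box.imp A.box) :=
  .base (.inl (.inr ⟨_, rfl⟩))

theorem box_bot_iff : ilMinus X (UFormula.bot.box.iff UFormula.bot.int) :=
  .base (.inr rfl)

theorem box_mono (h : ilMinus X (A.imp B)) : ilMinus X (A.box.imp B.box) :=
  .mp (.nec h) box_imp

theorem box_mono₂ (h : ilMinus X (A.imp (B.imp C))) :
    ilMinus X (A.box.imp (B.box.imp C.box)) :=
  trans (box_mono h) box_imp

/-- Used to absorb the disjunct `I ⊥` when the translation of J6 is checked. -/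
theorem box_of_int_bot : ilMinus X (UFormula.bot.int.imp A.box) :=
  taut₂ box_bot_iff (box_mono (A := .bot) (B := A) (taut fun v hv => by simp [hv.imp, hv.bot]))
    fun v hv => by simp only [hv.imp, hv.iff]; tauto

theorem int_of_box_bot : ilMinus X (UFormula.bot.box.imp A.int) :=
  taut₂ box_bot_iff (.r (A := .bot) (B := A) (taut fun v hv => by simp [hv.imp, hv.bot]))
    fun v hv => by simp only [hv.imp, hv.iff]; tauto

/-- `□A → □□A`, by Löb's axiom for `A ∧ □A`. -/
theorem box_box : ilMinus X (A.box.imp A.box.box) := by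
  have left : ilMinus X ((A.and A.box).box.imp A.box) :=
    box_mono (taut fun v hv => by simp only [hv.imp, hv.and]; tauto)
  have right : ilMinus X ((A.and A.box).box.imp A.box.box) :=
    box_mono (taut fun v hv => by simp only [hv.imp, hv.and]; tauto)
  have step : ilMinus X (A.box.imp ((A.and A.box).box.imp (A.and A.box)).box) :=
    box_mono (taut₁ left fun v hv => by simp only [hv.imp, hv.and]; tauto)
  exact trans (trans step loeb) right

theorem dia_mono (h : ilMinus X (A.imp B)) : ilMinus X (A.dia.imp B.dia) :=
  taut₁ (box_mono (A := B.neg) (B := A.neg)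
      (taut₁ h fun v hv => by simp only [hv.imp, hv.neg]; tauto))
    fun v hv => by simp only [UFormula.dia, hv.imp, hv.neg]; tauto

theorem dia_of_box_imp : ilMinus X ((A.imp B).box.imp (A.dia.imp B.dia)) :=
  taut₁ (box_mono₂ (A := A.imp B) (B := B.neg) (C := A.neg)
      (taut fun v hv => by simp only [hv.imp, hv.neg]; tauto))
    fun v hv => by simp only [UFormula.dia, hv.imp, hv.neg]; tauto

theorem not_dia_bot : ilMinus X UFormula.bot.dia.neg :=
  taut₁ (.nec (A := UFormula.bot.neg) (taut fun v hv => (hv.neg _).2 hv.bot))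
    fun v hv => by simp only [UFormula.dia, hv.neg]; tauto

/-- `□◇A → □⊥`, by Löb's axiom for `⊥`. -/
theorem box_bot_of_box_dia : ilMinus X (A.dia.box.imp UFormula.bot.box) := by
  have h : ilMinus X (UFormula.bot.box.imp A.neg.box) :=
    box_mono (taut fun v hv => by simp [hv.imp, hv.bot])
  -- Contraposing `h`, `◇A` yields `□⊥ → ⊥`, the premise of Löb's axiom under the box.
  refine trans (box_mono (taut₁ h fun v hv => ?_)) loeb
  simp only [UFormula.dia, hv.imp, hv.neg, hv.bot]; tauto

theorem int_of_box_imp (hX : I2 ⊆ X) : ilMinus X ((A.imp B).box.imp (A.int.imp B.int)) :=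
  .extra (hX ⟨_, _, rfl⟩)

theorem int_of_box (hX : uJ1 ⊆ X) : ilMinus X (A.box.imp A.int) :=
  .extra (hX ⟨_, rfl⟩)

end ilMinus

/-! ### Interpreting `▷` in the unary language -/

/-- The translation that reads `A ▷ B` as `τ A B`. -/
def BFormula.toU (τ : UFormula → UFormula → UFormula) : BFormula → UFormula
  | bot => .bot
  | var n => .var n
  | imp A B => (A.toU τ).imp (B.toU τ)
  | box A => (A.toU τ).box
  | rhd A B => τ (A.toU τ) (B.toU τ)

/-- The translation commutes with `⊥` and `→`, so a valuation pulls back along it. -/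
theorem BFormula.IsTautology.toU (τ : UFormula → UFormula → UFormula) {A : BFormula}
    (h : A.IsTautology) : (A.toU τ).IsTautology :=
  fun v hb hi => h (fun F => v (F.toU τ)) hb fun _ _ => hi _ _

/-- If `τ ⊤ B` is provably equivalent to `I B`, then translating the reading of `A` gives back a
formula provably equivalent to `A`. -/
theorem toU_toB_iff {X : Set UFormula} {τ : UFormula → UFormula → UFormula}
    (hτ : ∀ B, ilMinus X ((τ .top B).iff B.int)) (A : UFormula) :
    ilMinus X ((A.toB.toU τ).iff A) := by
  have split {P Q : UFormula} (h : ilMinus X (P.iff Q)) :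
      ilMinus X (P.imp Q) ∧ ilMinus X (Q.imp P) :=
    ⟨.taut₁ h fun v hv => by simp only [hv.imp, hv.iff]; tauto,
      .taut₁ h fun v hv => by simp only [hv.imp, hv.iff]; tauto⟩
  have join {P Q : UFormula} (h : ilMinus X (P.imp Q)) (h' : ilMinus X (Q.imp P)) :
      ilMinus X (P.iff Q) :=
    .taut₂ h h' fun v hv => by simp only [hv.imp, hv.iff]; tauto
  induction A with
  | bot => exact .taut fun v hv => (hv.iff _ _).2 Iff.rfl
  | var n => exact .taut fun v hv => (hv.iff _ _).2 Iff.rfl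
  | imp A B ihA ihB =>
    refine .taut₂ ihA ihB fun v hv => ?_
    simp only [UFormula.toB, BFormula.toU, hv.imp, hv.iff]; tauto
  | box A ih =>
    exact join (.box_mono (split ih).1) (.box_mono (split ih).2)
  | int A ih =>
    exact .taut₂ (hτ (A.toB.toU τ)) (join (.r (split ih).1) (.r (split ih).2)) fun v hv h h' =>
      (hv.iff _ _).2 (((hv.iff _ _).1 h).trans ((hv.iff _ _).1 h'))

theorem mem_of_toU_toB_mem {X : Set UFormula} {τ : UFormula → UFormula → UFormula}
    (hτ : ∀ B, ilMinus X ((τ .top B).iff B.int)) {A : UFormula}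
    (hA : ilMinus X (A.toB.toU τ)) : A ∈ ilMinus X :=
  .taut₂ (toU_toB_iff hτ A) hA fun _ hv h => ((hv.iff _ _).1 h).1

/-- `il⁻(X)` proves the translations of the theorems of `IL⁻(Y)` as soon as `τ` satisfies the
axioms and rules for `▷`. -/
theorem toU_mem_ilMinus {X : Set UFormula} {Y : Set BFormula}
    {τ : UFormula → UFormula → UFormula}
    (hJ3 : ∀ A B C, ilMinus X (((τ A C).and (τ B C)).imp (τ (A.or B) C)))
    (hJ6 : ∀ A : UFormula, ilMinus X (A.box.iff (τ A.neg .bot)))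
    (hR1 : ∀ A B C, ilMinus X (A.imp B) → ilMinus X ((τ C A).imp (τ C B)))
    (hR2 : ∀ A B C, ilMinus X (A.imp B) → ilMinus X ((τ B C).imp (τ A C)))
    (hY : ∀ F ∈ Y, ilMinus X (F.toU τ)) {F : BFormula} (hF : F ∈ ILMinus Y) :
    ilMinus X (F.toU τ) := by
  change ILMinus Y F at hF
  induction hF with
  | base h =>
    rcases h with (((h | ⟨A, B, rfl⟩) | ⟨A, rfl⟩) | ⟨A, B, C, rfl⟩) | ⟨A, rfl⟩
    · exact .base (.inl (.inl (.inl (h.toU τ))))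
    · exact .box_imp
    · exact .loeb
    · exact hJ3 _ _ _
    · exact hJ6 _
  | extra h => exact hY _ h
  | mp _ _ ih₁ ih₂ => exact .mp ih₁ ih₂
  | nec _ ih => exact .nec ih
  | r1 C _ ih => exact hR1 _ _ _ ih
  | r2 C _ ih => exact hR2 _ _ _ ih

/-! ### The interpretation of `A ▷ B` as `□(A → ◇B) ∨ I B` -/

/-- `□(A → ◇B) ∨ I B` -/
def diaRhd (A B : UFormula) : UFormula := (A.imp B.dia).box.or B.int

/-- The boxed disjunct is harmless at `⊤`: it becomes `□◇B`, which by Löb gives `□⊥`, hence `I B`.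
-/
theorem diaRhd_top_iff {X : Set UFormula} (B : UFormula) :
    ilMinus X ((diaRhd .top B).iff B.int) := by
  have h : ilMinus X ((UFormula.top.imp B.dia).box.imp B.dia.box) :=
    .box_mono (.taut fun v hv => by simp [hv.imp, hv.top])
  refine .taut₁ (h.trans (ilMinus.box_bot_of_box_dia.trans (.int_of_box_bot (A := B))))
    fun v hv => ?_
  simp only [diaRhd, hv.imp, hv.or, hv.iff]; tauto

/-- `□(A → B) → (C ▷ A → C ▷ B)` for `▷` read as `diaRhd`. -/
theorem diaRhd_right_of_box_imp {X : Set UFormula} (hX : I2 ⊆ X) (A B C : UFormula) :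
    ilMinus X ((A.imp B).box.imp ((diaRhd C A).imp (diaRhd C B))) := by
  -- `□(A → B)` is needed inside the box to pass from `◇A` to `◇B`; transitivity supplies the second
  -- box.
  have h : ilMinus X ((A.imp B).box.box.imp ((C.imp A.dia).box.imp (C.imp B.dia).box)) :=
    .box_mono₂ (.taut₁ (.dia_of_box_imp (A := A) (B := B))
      fun v hv => by simp only [hv.imp]; tauto)
  refine .taut₃ (.box_box (A := A.imp B)) h (.int_of_box_imp (A := A) (B := B) hX) fun v hv => ?_
  simp only [diaRhd, hv.imp, hv.or]; tauto

theorem toU_diaRhd_mem {X : Set UFormula} {Y : Set BFormula}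
    (hY : ∀ F ∈ Y, ilMinus X (F.toU diaRhd)) {F : BFormula} (hF : F ∈ ILMinus Y) :
    ilMinus X (F.toU diaRhd) := by
  refine toU_mem_ilMinus (fun A B C => ?_) (fun A => ?_) (fun A B C h => ?_) (fun A B C h => ?_)
    hY hF
  · have h : ilMinus X ((A.imp C.dia).box.imp
        ((B.imp C.dia).box.imp ((A.or B).imp C.dia).box)) :=
      .box_mono₂ (.taut fun v hv => by simp only [hv.imp, hv.or]; tauto)
    refine .taut₁ h fun v hv => ?_
    simp only [diaRhd, hv.imp, hv.or, hv.and]; tauto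
  -- J6: as `◇⊥` is refutable, the boxed disjunct is equivalent to `□A`, and `I ⊥` implies `□A`.
  · have h₁ : ilMinus X (A.box.imp (A.neg.imp UFormula.bot.dia).box) :=
      .box_mono (.taut fun v hv => by simp only [hv.imp, hv.neg]; tauto)
    have h₂ : ilMinus X ((A.neg.imp UFormula.bot.dia).box.imp A.box) :=
      .box_mono (.taut₁ .not_dia_bot fun v hv => by simp only [hv.imp, hv.neg]; tauto)
    refine .taut₃ h₁ h₂ (.box_of_int_bot (A := A)) fun v hv => ?_
    simp only [diaRhd, hv.imp, hv.or, hv.iff]; tauto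
  · have h' : ilMinus X ((C.imp A.dia).box.imp (C.imp B.dia).box) :=
      .box_mono (.taut₁ (.dia_mono h) fun v hv => by simp only [hv.imp]; tauto)
    refine .taut₂ h' (.r h) fun v hv => ?_
    simp only [diaRhd, hv.imp, hv.or]; tauto
  · have h' : ilMinus X ((B.imp C.dia).box.imp (A.imp C.dia).box) :=
      .box_mono (.taut₁ h fun v hv => by simp only [hv.imp]; tauto)
    refine .taut₁ h' fun v hv => ?_
    simp only [diaRhd, hv.imp, hv.or]; tauto

/-- The first disjunct is the necessitation of `◇A → ◇A`; this is why `diaRhd` has a diamond. -/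
theorem toU_diaRhd_J5 {X : Set UFormula} {F : BFormula} (hF : F ∈ J5) :
    ilMinus X (F.toU diaRhd) := by
  obtain ⟨A, rfl⟩ := hF
  have h : ilMinus X (((A.toU diaRhd).dia.imp (A.toU diaRhd).dia).box) :=
    .nec (.taut fun v hv => (hv.imp _ _).2 id)
  exact .taut₁ h fun v hv h => (hv.or _ _).2 (.inl h)

theorem toU_diaRhd_J4plus {X : Set UFormula} (hX : I2 ⊆ X) {F : BFormula} (hF : F ∈ J4plus) :
    ilMinus X (F.toU diaRhd) := by
  obtain ⟨A, B, C, rfl⟩ := hF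
  exact diaRhd_right_of_box_imp hX _ _ _

theorem mem_of_toB_mem_J5 {A : UFormula} (hA : A.toB ∈ ILMinus J5) : A ∈ ilMinus ∅ :=
  mem_of_toU_toB_mem diaRhd_top_iff (toU_diaRhd_mem (fun _ => toU_diaRhd_J5) hA)

theorem mem_of_toB_mem_J4plus_J5 {A : UFormula} (hA : A.toB ∈ ILMinus (J4plus ∪ J5)) :
    A ∈ ilMinus I2 :=
  mem_of_toU_toB_mem diaRhd_top_iff
    (toU_diaRhd_mem (fun _ h => h.elim (toU_diaRhd_J4plus le_rfl) toU_diaRhd_J5) hA)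

/-! ### The interpretation of `A ▷ B` as `□¬A ∨ I B` -/

/-- `□¬A ∨ I B` -/
def negRhd (A B : UFormula) : UFormula := A.neg.box.or B.int

/-- Here the boxed disjunct is `□¬⊤`, which is `□⊥` and so implies `I B`. -/
theorem negRhd_top_iff {X : Set UFormula} (B : UFormula) :
    ilMinus X ((negRhd .top B).iff B.int) := by
  have h : ilMinus X (UFormula.top.neg.box.imp UFormula.bot.box) :=
    .box_mono (.taut fun v hv => by simp [hv.imp, hv.neg, hv.top])
  refine .taut₁ (h.trans (.int_of_box_bot (A := B))) fun v hv => ?_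
  simp only [negRhd, hv.imp, hv.or, hv.iff]; tauto

/-- The one case not propositional is `I(B ∨ C)` with `□¬B`: then `B ∨ C → C` is necessary, and I2
gives `I C`. -/
theorem toU_negRhd_J2plus {X : Set UFormula} (hX : I2 ⊆ X) {F : BFormula} (hF : F ∈ J2plus) :
    ilMinus X (F.toU negRhd) := by
  obtain ⟨A, B, C, rfl⟩ := hF
  change ilMinus X (UFormula.imp (UFormula.and (negRhd (A.toU negRhd)
    ((B.toU negRhd).or (C.toU negRhd))) (negRhd (B.toU negRhd) (C.toU negRhd)))
    (negRhd (A.toU negRhd) (C.toU negRhd)))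
  generalize A.toU negRhd = A, B.toU negRhd = B, C.toU negRhd = C
  have h : ilMinus X (B.neg.box.imp ((B.or C).imp C).box) :=
    .box_mono (.taut fun v hv => by simp only [hv.imp, hv.neg, hv.or]; tauto)
  refine .taut₂ h (.int_of_box_imp (A := B.or C) (B := C) hX) fun v hv => ?_
  simp only [negRhd, hv.imp, hv.or, hv.and]; tauto

theorem toU_negRhd_mem {X : Set UFormula} {Y : Set BFormula}
    (hY : ∀ F ∈ Y, ilMinus X (F.toU negRhd)) {F : BFormula} (hF : F ∈ ILMinus Y) :
    ilMinus X (F.toU negRhd) := by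
  refine toU_mem_ilMinus (fun A B C => ?_) (fun A => ?_) (fun A B C h => ?_) (fun A B C h => ?_)
    hY hF
  · have h : ilMinus X (A.neg.box.imp (B.neg.box.imp (A.or B).neg.box)) :=
      .box_mono₂ (.taut fun v hv => by simp only [hv.imp, hv.or, hv.neg]; tauto)
    refine .taut₁ h fun v hv => ?_
    simp only [negRhd, hv.imp, hv.or, hv.and]; tauto
  · have h₁ : ilMinus X (A.box.imp A.neg.neg.box) :=
      .box_mono (.taut fun v hv => by simp only [hv.imp, hv.neg]; tauto)
    have h₂ : ilMinus X (A.neg.neg.box.imp A.box) :=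
      .box_mono (.taut fun v hv => by simp only [hv.imp, hv.neg]; tauto)
    refine .taut₃ h₁ h₂ (.box_of_int_bot (A := A)) fun v hv => ?_
    simp only [negRhd, hv.imp, hv.or, hv.iff]; tauto
  · refine .taut₁ (.r h) fun v hv => ?_
    simp only [negRhd, hv.imp, hv.or]; tauto
  · have h' : ilMinus X (B.neg.box.imp A.neg.box) :=
      .box_mono (.taut₁ h fun v hv => by simp only [hv.imp, hv.neg]; tauto)
    refine .taut₁ h' fun v hv => ?_
    simp only [negRhd, hv.imp, hv.or]; tauto

theorem mem_of_toB_mem_J2plus {A : UFormula} (hA : A.toB ∈ ILMinus J2plus) : A ∈ ilMinus I2 :=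
  mem_of_toU_toB_mem negRhd_top_iff
    (toU_negRhd_mem (fun _ => toU_negRhd_J2plus le_rfl) hA)

/-! ### The interpretation of `A ▷ B` as `□(A → B) ∨ I B` -/

/-- `□(A → B) ∨ I B` -/
def impRhd (A B : UFormula) : UFormula := (A.imp B).box.or B.int

section

variable {X : Set UFormula}

/-- At `⊤` the boxed disjunct is `□B`, and only here does this interpretation need `□B → I B`. -/
theorem impRhd_top_iff (hX : uJ1 ⊆ X) (B : UFormula) :
    ilMinus X ((impRhd .top B).iff B.int) := by
  have h : ilMinus X ((UFormula.top.imp B).box.imp B.box) :=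
    .box_mono (.taut fun v hv => by simp [hv.imp, hv.top])
  refine .taut₁ (h.trans (.int_of_box hX)) fun v hv => ?_
  simp only [impRhd, hv.imp, hv.or, hv.iff]; tauto

theorem impRhd_trans (hX : I2 ⊆ X) (A B C : UFormula) :
    ilMinus X (((impRhd A B).and (impRhd B C)).imp (impRhd A C)) := by
  have h : ilMinus X ((A.imp B).box.imp ((B.imp C).box.imp (A.imp C).box)) :=
    .box_mono₂ (.taut fun v hv => by simp only [hv.imp]; tauto)
  refine .taut₂ h (.int_of_box_imp (A := B) (B := C) hX) fun v hv => ?_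
  simp only [impRhd, hv.imp, hv.or, hv.and]; tauto

theorem impRhd_or_left (A B C : UFormula) :
    ilMinus X (((impRhd A C).and (impRhd B C)).imp (impRhd (A.or B) C)) := by
  have h : ilMinus X ((A.imp C).box.imp ((B.imp C).box.imp ((A.or B).imp C).box)) :=
    .box_mono₂ (.taut fun v hv => by simp only [hv.imp, hv.or]; tauto)
  refine .taut₁ h fun v hv => ?_
  simp only [impRhd, hv.imp, hv.or, hv.and]; tauto

/-- For the disjunct `I B`, contrapose: `□¬B` and I2 turn it into `I ⊥`, which yields `□¬A`. -/
theorem impRhd_dia (hX : I2 ⊆ X) (A B : UFormula) :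
    ilMinus X ((impRhd A B).imp (A.dia.imp B.dia)) := by
  have h : ilMinus X (B.neg.box.imp (B.int.imp A.neg.box)) :=
    .taut₂ (.int_of_box_imp (A := B) (B := .bot) hX) (.box_of_int_bot (A := A.neg))
      fun v hv => by simp only [hv.imp, UFormula.neg]; tauto
  refine .taut₂ (.dia_of_box_imp (A := A) (B := B)) h fun v hv => ?_
  simp only [impRhd, UFormula.dia, hv.imp, hv.or, hv.neg]; tauto

theorem toU_impRhd_mem (hX : I2 ⊆ X) {F : BFormula} (hF : F ∈ CL) :
    ilMinus X (F.toU impRhd) := by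
  change CL F at hF
  induction hF with
  | ax h =>
    rcases h with (((((h | ⟨A, B, rfl⟩) | ⟨A, rfl⟩) | ⟨A, B, rfl⟩) | ⟨A, B, C, rfl⟩) |
      ⟨A, B, C, rfl⟩) | ⟨A, B, rfl⟩
    · exact .base (.inl (.inl (.inl (h.toU _))))
    · exact .box_imp
    · exact .loeb
    -- J1: its premise is literally the first disjunct of `impRhd`.
    · exact .taut fun v hv => (hv.imp _ _).2 fun h => (hv.or _ _).2 (.inl h)
    · exact impRhd_trans hX _ _ _
    · exact impRhd_or_left _ _ _
    · exact impRhd_dia hX _ _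
  | mp _ _ ih₁ ih₂ => exact .mp ih₁ ih₂
  | nec _ ih => exact .nec ih

end

theorem mem_of_toB_mem_CL {A : UFormula} (hA : A.toB ∈ CL) : A ∈ ilMinus (uJ1 ∪ I2) :=
  mem_of_toU_toB_mem (impRhd_top_iff Set.subset_union_left)
    (toU_impRhd_mem Set.subset_union_right hA)

end IntLogic

theorem mainTheorem4 (A : IntLogic.UFormula) (L : Set IntLogic.BFormula) :
    (IntLogic.ILMinus ∅ ⊆ L → L ⊆ IntLogic.ILMinus IntLogic.J5 →
      (A.toB ∈ L ↔ A ∈ IntLogic.ilMinus ∅)) ∧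
    ((IntLogic.ILMinus IntLogic.J4plus ⊆ L ∧
          L ⊆ IntLogic.ILMinus (IntLogic.J4plus ∪ IntLogic.J5)) ∨
        (IntLogic.ILMinus IntLogic.J4plus ⊆ L ∧ L ⊆ IntLogic.ILMinus IntLogic.J2plus) →
      (A.toB ∈ L ↔ A ∈ IntLogic.ilMinus IntLogic.I2)) ∧
    (IntLogic.ILMinus (IntLogic.J1 ∪ IntLogic.J4plus) ⊆ L → L ⊆ IntLogic.CL →
      (A.toB ∈ L ↔ A ∈ IntLogic.ilMinus (IntLogic.uJ1 ∪ IntLogic.I2))) := by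
  have embed_I2 (h : A ∈ IntLogic.ilMinus IntLogic.I2) :
      A.toB ∈ IntLogic.ILMinus IntLogic.J4plus :=
    IntLogic.toB_mem_ILMinus (fun _ => IntLogic.toB_I2_mem le_rfl) h
  refine ⟨fun h₁ h₂ => ⟨fun h => IntLogic.mem_of_toB_mem_J5 (h₂ h), fun h => h₁ ?_⟩, ?_,
    fun h₁ h₂ => ⟨fun h => IntLogic.mem_of_toB_mem_CL (h₂ h), fun h => h₁ ?_⟩⟩
  · exact IntLogic.toB_mem_ILMinus (fun _ => False.elim) h
  · rintro (⟨h₁, h₂⟩ | ⟨h₁, h₂⟩)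
    · exact ⟨fun h => IntLogic.mem_of_toB_mem_J4plus_J5 (h₂ h), fun h => h₁ (embed_I2 h)⟩
    · exact ⟨fun h => IntLogic.mem_of_toB_mem_J2plus (h₂ h), fun h => h₁ (embed_I2 h)⟩
  · exact IntLogic.toB_mem_ILMinus (fun _ h => h.elim (IntLogic.toB_uJ1_mem Set.subset_union_left)
      (IntLogic.toB_I2_mem Set.subset_union_right)) h
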